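/- Let $n\ge 3$ and let $s\in\mathbb{Z}_n\setminus\{0\}$. The generalized Petersen graph $\mathrm{GP}(n,s)$ is the simple graph with vertex set $\{u_i, v_i : i\in\mathbb{Z}_n\}$ and edges $u_iu_{i+1}$, $u_iv_i$ and $v_iv_{i+s}$ for $i\in\mathbb{Z}_n$; thus $\mathrm{GP}(n,s)=\mathrm{GP}(n,-s)$. A graph is edge-transitive (respectively arc-transitive) if its automorphism group acts transitively on its edges (respectively on its ordered pairs of adjacent vertices). Then $\mathrm{GP}(n,s)$ is edge-transitive if and only if, after possibly replacing $s$ by $-s$, the pair $(n,s)$ is one of $$(4,1),\ (5,2),\ (8,3),\ (10,2),\ (10,3),\ (12,5),\ (24,5).$$ Moreover, if $\mathrm{GP}(n,s)$ is edge-transitive, then it is arc-transitive. -/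

import Mathlib

/-- The generalized Petersen graph `GP(n,s)`: the bicirculant over `ZMod n` with symbol
`[[{1,-1}, {0}], [{0}, {s,-s}]]`. The two orbits of `ZMod n` are `Sum.inl` (outer rim) and
`Sum.inr` (inner rim); an entry `S i j` of the symbol lists the differences along the arcs from
orbit `i` to orbit `j`. (For `n ≥ 2` and `s ≠ 0` the conditions `i ≠ j` are automatic.) -/
def genPetersen (n : ℕ) (s : ZMod n) : SimpleGraph (ZMod n ⊕ ZMod n) where
  Adj
    | Sum.inl i, Sum.inl j => i ≠ j ∧ (j - i = 1 ∨ j - i = -1)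
    | Sum.inl i, Sum.inr j => j - i = 0
    | Sum.inr i, Sum.inl j => j - i = 0
    | Sum.inr i, Sum.inr j => i ≠ j ∧ (j - i = s ∨ j - i = -s)
  symm := ⟨by
    rintro (i | i) (j | j) h
    · exact ⟨h.1.symm, h.2.symm.imp (fun e => by rw [← neg_sub, e, neg_neg])
        (fun e => by rw [← neg_sub, e])⟩
    · exact (sub_eq_zero.2 (sub_eq_zero.1 h).symm :)
    · exact (sub_eq_zero.2 (sub_eq_zero.1 h).symm :)
    · exact ⟨h.1.symm, h.2.symm.imp (fun e => by rw [← neg_sub, e, neg_neg])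
        (fun e => by rw [← neg_sub, e])⟩⟩
  loopless := ⟨by
    rintro (i | i) h
    · exact h.1 rfl
    · exact h.1 rfl⟩

/-- The automorphism group of `G` acts transitively on the edges of `G`. -/
def SimpleGraph.IsEdgeTransitive {V : Type*} (G : SimpleGraph V) : Prop :=
  ∀ e ∈ G.edgeSet, ∀ f ∈ G.edgeSet, ∃ φ : G ≃g G, Sym2.map φ e = f

/-- The automorphism group of `G` acts transitively on the arcs (ordered pairs of adjacent
vertices) of `G`. -/
def SimpleGraph.IsArcTransitive {V : Type*} (G : SimpleGraph V) : Prop :=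
  ∀ u v x y : V, G.Adj u v → G.Adj x y → ∃ φ : G ≃g G, φ u = x ∧ φ v = y

/-- The list of exceptional parameter pairs `(n, s)`. -/
def gpPairs : Finset (ℕ × ℕ) :=
  {(4, 1), (5, 2), (8, 3), (10, 2), (10, 3), (12, 5), (24, 5)}

/-! ### Automorphisms of generalized Petersen graphs -/

namespace SimpleGraph

/-! Rotations and the reflection act transitively on the outer arcs, on the inner arcs, and on the
spokes with a given direction. Hence an involution mixing these classes suffices for
arc-transitivity (`isArcTransitive_of_spoke_image`), and each exceptional pair has an explicit one.

Conversely, edge-transitivity forces the number of walks of length `k` between the ends of an edge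
to be the same for all edges. When the graph is cubic, walks lift to an abelian cover over `ℤ × ℤ`,
independent of `n` and `s`; the counts below are sums of fixed weights over the relations `a + b * s
= 0` in `ZMod n`. Each comparison of a rim edge with a spoke is thus a fixed finite table whose sum
over the relations must vanish (`IsOuterDefect.eval_eq_zero`, `IsInnerDefect.eval_eq_zero`).

Length seven is natural: the cover has 8-cycles, coming from the commutator of the two translations,
and each has four spokes but only two edges of each rim. This is the weight `-2` at the origin.

The tables for length seven live in the disc of radius 8. Two relations in it have determinant
divisible by `n` and at most 64, so for `n > 64` they are parallel and all short relations are
multiples of one vector (`exists_generator`). Finitely many vectors remain, and all fail. For `n ≤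
64` the pairs are checked directly, with length nine as an additional test. -/

theorem IsArcTransitive.isEdgeTransitive {V : Type*} {G : SimpleGraph V}
    (h : G.IsArcTransitive) : G.IsEdgeTransitive := by
  intro e he f hf
  induction e with | _ u v =>
  induction f with | _ x y =>
  obtain ⟨φ, hu, hv⟩ := h u v x y he hf
  exact ⟨φ, by rw [Sym2.map_mk, hu, hv]⟩

/-- Two pairs of vertices are in the same orbit of the automorphism group. -/
def SameOrbit {V : Type*} (G : SimpleGraph V) (p q : V × V) : Prop :=
  ∃ φ : G ≃g G, φ p.1 = q.1 ∧ φ p.2 = q.2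

theorem SameOrbit.symm {V : Type*} {G : SimpleGraph V} {p q : V × V}
    (h : G.SameOrbit p q) : G.SameOrbit q p := by
  obtain ⟨φ, h₁, h₂⟩ := h
  exact ⟨φ.symm, by rw [← h₁, RelIso.symm_apply_apply], by rw [← h₂, RelIso.symm_apply_apply]⟩

theorem SameOrbit.trans {V : Type*} {G : SimpleGraph V} {p q r : V × V}
    (h : G.SameOrbit p q) (h' : G.SameOrbit q r) : G.SameOrbit p r := by
  obtain ⟨φ, h₁, h₂⟩ := h
  obtain ⟨ψ, h₃, h₄⟩ := h'
  exact ⟨φ.trans ψ, by simp [h₁, h₃], by simp [h₂, h₄]⟩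

end SimpleGraph

namespace genPetersen

open SimpleGraph

theorem eq_neg (n : ℕ) (s : ZMod n) : genPetersen n (-s) = genPetersen n s := by
  ext x y
  rcases x with i | i <;> rcases y with j | j <;> simp [genPetersen, or_comm]

theorem adj_inl_inl {n : ℕ} {s i j : ZMod n} : (genPetersen n s).Adj (.inl i) (.inl j) ↔
    i ≠ j ∧ (j - i = 1 ∨ j - i = -1) := Iff.rfl

theorem adj_inr_inr {n : ℕ} {s i j : ZMod n} : (genPetersen n s).Adj (.inr i) (.inr j) ↔
    i ≠ j ∧ (j - i = s ∨ j - i = -s) := Iff.rfl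

theorem adj_inl_inr {n : ℕ} {s i j : ZMod n} : (genPetersen n s).Adj (.inl i) (.inr j) ↔
    j - i = 0 := Iff.rfl

theorem adj_inr_inl {n : ℕ} {s i j : ZMod n} : (genPetersen n s).Adj (.inr i) (.inl j) ↔
    j - i = 0 := Iff.rfl

instance decidableAdj (n : ℕ) (s : ZMod n) : DecidableRel (genPetersen n s).Adj
  | .inl i, .inl j => inferInstanceAs (Decidable (i ≠ j ∧ (j - i = 1 ∨ j - i = -1)))
  | .inl i, .inr j => inferInstanceAs (Decidable (j - i = 0))
  | .inr i, .inl j => inferInstanceAs (Decidable (j - i = 0))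
  | .inr i, .inr j => inferInstanceAs (Decidable (i ≠ j ∧ (j - i = s ∨ j - i = -s)))

/-- The rotation of a generalized Petersen graph by `c`. -/
def rotation (n : ℕ) (s c : ZMod n) : genPetersen n s ≃g genPetersen n s where
  toEquiv := (Equiv.addRight c).sumCongr (Equiv.addRight c)
  map_rel_iff' := by
    rintro (i | i) (j | j) <;> simp [genPetersen]

/-- The reflection of a generalized Petersen graph that fixes the spoke at `0`. -/
def reflection (n : ℕ) (s : ZMod n) : genPetersen n s ≃g genPetersen n s where
  toEquiv := (Equiv.neg _).sumCongr (Equiv.neg _)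
  map_rel_iff' := by
    rintro (i | i) (j | j) <;>
      simp [genPetersen, neg_add_eq_sub, ← neg_sub j i, neg_eq_iff_eq_neg, or_comm, -neg_sub]

@[simp] theorem rotation_inl (n : ℕ) (s c i : ZMod n) :
    rotation n s c (.inl i) = .inl (i + c) := rfl

@[simp] theorem rotation_inr (n : ℕ) (s c i : ZMod n) :
    rotation n s c (.inr i) = .inr (i + c) := rfl

@[simp] theorem reflection_inl (n : ℕ) (s i : ZMod n) :
    reflection n s (.inl i) = .inl (-i) := rfl

@[simp] theorem reflection_inr (n : ℕ) (s i : ZMod n) :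
    reflection n s (.inr i) = .inr (-i) := rfl

theorem sameOrbit_outer {n : ℕ} {s i j : ZMod n}
    (h : (genPetersen n s).Adj (.inl i) (.inl j)) :
    (genPetersen n s).SameOrbit (.inl 0, .inl 1) (.inl i, .inl j) := by
  obtain ⟨-, h | h⟩ := adj_inl_inl.1 h
  · exact ⟨rotation n s i, by simp, by simp [← h]⟩
  · refine ⟨(reflection n s).trans (rotation n s i), by simp, ?_⟩
    simp [← h]

theorem sameOrbit_inner {n : ℕ} {s i j : ZMod n}
    (h : (genPetersen n s).Adj (.inr i) (.inr j)) :
    (genPetersen n s).SameOrbit (.inr 0, .inr s) (.inr i, .inr j) := by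
  obtain ⟨-, h | h⟩ := adj_inr_inr.1 h
  · exact ⟨rotation n s i, by simp, by simp [← h]⟩
  · refine ⟨(reflection n s).trans (rotation n s i), by simp, ?_⟩
    simp [← h]

theorem sameOrbit_spoke {n : ℕ} {s i j : ZMod n}
    (h : (genPetersen n s).Adj (.inl i) (.inr j)) :
    (genPetersen n s).SameOrbit (.inl 0, .inr 0) (.inl i, .inr j) :=
  ⟨rotation n s i, by simp, by simp [sub_eq_zero.1 (adj_inl_inr.1 h)]⟩

theorem sameOrbit_spoke_symm {n : ℕ} {s i j : ZMod n}
    (h : (genPetersen n s).Adj (.inr i) (.inl j)) :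
    (genPetersen n s).SameOrbit (.inr 0, .inl 0) (.inr i, .inl j) :=
  ⟨rotation n s i, by simp, by simp [sub_eq_zero.1 (adj_inr_inl.1 h)]⟩

/-- If some automorphism takes an outer edge to a spoke, and some automorphism takes an inner edge
to a spoke, then the graph is arc-transitive. -/
theorem isArcTransitive_of_spoke_image {n : ℕ} {s : ZMod n}
    {φ ψ : genPetersen n s ≃g genPetersen n s} {i j k l : ZMod n}
    (hij : (genPetersen n s).Adj (.inl i) (.inl j))
    (hkl : (genPetersen n s).Adj (.inr k) (.inr l))
    (hφ : (φ (.inl i)).isLeft ∧ (φ (.inl j)).isRight)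
    (hψ : (ψ (.inr k)).isLeft ∧ (ψ (.inr l)).isRight) :
    (genPetersen n s).IsArcTransitive := by
  obtain ⟨a, ha⟩ := Sum.isLeft_iff.1 hφ.1
  obtain ⟨b, hb⟩ := Sum.isRight_iff.1 hφ.2
  obtain ⟨c, hc⟩ := Sum.isLeft_iff.1 hψ.1
  obtain ⟨d, hd⟩ := Sum.isRight_iff.1 hψ.2
  have hab : (genPetersen n s).Adj (.inl a) (.inr b) := by
    rw [← ha, ← hb]; exact φ.map_adj_iff.2 hij
  have hcd : (genPetersen n s).Adj (.inl c) (.inr d) := by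
    rw [← hc, ← hd]; exact ψ.map_adj_iff.2 hkl
  have spoke : (genPetersen n s).SameOrbit (.inl 0, .inl 1) (.inl 0, .inr 0) :=
    ((sameOrbit_outer hij).trans ⟨φ, ha, hb⟩).trans (sameOrbit_spoke hab).symm
  have spoke_symm : (genPetersen n s).SameOrbit (.inl 0, .inl 1) (.inr 0, .inl 0) :=
    ((sameOrbit_outer hij.symm).trans ⟨φ, hb, ha⟩).trans (sameOrbit_spoke_symm hab.symm).symm
  have inner : (genPetersen n s).SameOrbit (.inl 0, .inl 1) (.inr 0, .inr s) :=
    spoke.trans <| (sameOrbit_spoke hcd).trans <|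
      (SameOrbit.symm ⟨ψ, hc, hd⟩).trans (sameOrbit_inner hkl).symm
  have all : ∀ x y, (genPetersen n s).Adj x y →
      (genPetersen n s).SameOrbit (.inl 0, .inl 1) (x, y) := by
    rintro (x | x) (y | y) h
    · exact sameOrbit_outer h
    · exact spoke.trans (sameOrbit_spoke h)
    · exact spoke_symm.trans (sameOrbit_spoke_symm h)
    · exact inner.trans (sameOrbit_inner h)
  intro u v x y huv hxy
  exact (all u v huv).symm.trans (all x y hxy)

/-- A map that preserves the three kinds of edges preserves adjacency. -/
theorem adj_map_of_edges {n : ℕ} {s : ZMod n} {f : ZMod n ⊕ ZMod n → ZMod n ⊕ ZMod n}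
    (ho : ∀ i, (genPetersen n s).Adj (f (.inl i)) (f (.inl (i + 1))))
    (hp : ∀ i, (genPetersen n s).Adj (f (.inl i)) (f (.inr i)))
    (hi : ∀ i, (genPetersen n s).Adj (f (.inr i)) (f (.inr (i + s)))) {x y : ZMod n ⊕ ZMod n}
    (h : (genPetersen n s).Adj x y) : (genPetersen n s).Adj (f x) (f y) := by
  rcases x with i | i <;> rcases y with j | j
  · obtain ⟨-, h | h⟩ := adj_inl_inl.1 h
    · rw [sub_eq_iff_eq_add'.1 h]; exact ho i
    · have : i = j + 1 := by linear_combination -h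
      rw [this]; exact (ho j).symm
  · rw [sub_eq_zero.1 (adj_inl_inr.1 h)]; exact hp i
  · rw [sub_eq_zero.1 (adj_inr_inl.1 h)]; exact (hp i).symm
  · obtain ⟨-, h | h⟩ := adj_inr_inr.1 h
    · rw [sub_eq_iff_eq_add'.1 h]; exact hi i
    · have : i = j + s := by linear_combination -h
      rw [this]; exact (hi j).symm

/-! ### Explicit involutions of the exceptional graphs -/

/-- The vertex map given by a list of codes, where `k < n` is the code of the outer vertex `k` and
`n + k` that of the inner vertex `k`. -/
def codedMap (n : ℕ) (codes : List ℕ) (x : ZMod n ⊕ ZMod n) : ZMod n ⊕ ZMod n :=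
  -- The default `0` is never reached for the lists used below, which have length `2 * n`.
  let k := codes.getD (x.elim ZMod.val fun i => n + i.val) 0
  if k < n then .inl k else .inr (k - n : ℕ)

/-- The list of codes describes an involutory automorphism taking an outer edge to a spoke and an
inner edge to a spoke. -/
def IsMixingInvolution (n : ℕ) (s : ZMod n) (codes : List ℕ) : Prop :=
  (∀ x, codedMap n codes (codedMap n codes x) = x) ∧
  (∀ i, (genPetersen n s).Adj (codedMap n codes (.inl i)) (codedMap n codes (.inl (i + 1)))) ∧
  (∀ i, (genPetersen n s).Adj (codedMap n codes (.inl i)) (codedMap n codes (.inr i))) ∧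
  (∀ i, (genPetersen n s).Adj (codedMap n codes (.inr i)) (codedMap n codes (.inr (i + s)))) ∧
  (∃ i j, (genPetersen n s).Adj (.inl i) (.inl j) ∧
    (codedMap n codes (.inl i)).isLeft ∧ (codedMap n codes (.inl j)).isRight) ∧
  (∃ i j, (genPetersen n s).Adj (.inr i) (.inr j) ∧
    (codedMap n codes (.inr i)).isLeft ∧ (codedMap n codes (.inr j)).isRight)

instance (n : ℕ) [NeZero n] (s : ZMod n) (codes : List ℕ) :
    Decidable (IsMixingInvolution n s codes) := by
  unfold IsMixingInvolution; infer_instance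

theorem IsMixingInvolution.isArcTransitive {n : ℕ} {s : ZMod n} {codes : List ℕ}
    (h : IsMixingInvolution n s codes) : (genPetersen n s).IsArcTransitive := by
  obtain ⟨hinv, ho, hp, hi, ⟨i, j, hij, hφ⟩, k, l, hkl, hψ⟩ := h
  let φ : genPetersen n s ≃g genPetersen n s :=
    { toEquiv := Function.Involutive.toPerm (codedMap n codes) hinv
      map_rel_iff' := fun {x y} => by
        refine ⟨fun hxy => ?_, fun hxy => adj_map_of_edges ho hp hi hxy⟩
        -- An involution is its own inverse, so preserving adjacency in one direction is enough.
        have : (genPetersen n s).Adj (codedMap n codes (codedMap n codes x))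
          (codedMap n codes (codedMap n codes y)) := adj_map_of_edges ho hp hi hxy
        rwa [hinv x, hinv y] at this }
  exact isArcTransitive_of_spoke_image (φ := φ) (ψ := φ) hij hkl hφ hψ

theorem isArcTransitive_of_mem_gpPairs {n m : ℕ} (h : (n, m) ∈ gpPairs) :
    (genPetersen n (m : ZMod n)).IsArcTransitive := by
  simp only [gpPairs, Finset.mem_insert, Finset.mem_singleton, Prod.mk.injEq] at h
  obtain ⟨rfl, rfl⟩ | ⟨rfl, rfl⟩ | ⟨rfl, rfl⟩ | ⟨rfl, rfl⟩ | ⟨rfl, rfl⟩ | ⟨rfl, rfl⟩ |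
    ⟨rfl, rfl⟩ := h
  · exact IsMixingInvolution.isArcTransitive (codes := [0, 1, 5, 4, 3, 2, 6, 7])
      (by decide +kernel)
  · exact IsMixingInvolution.isArcTransitive (codes := [0, 1, 6, 9, 4, 5, 2, 8, 7, 3])
      (by decide +kernel)
  · exact IsMixingInvolution.isArcTransitive
      (codes := [0, 8, 11, 3, 4, 12, 15, 7, 1, 13, 14, 2, 5, 9, 10, 6]) (by decide +kernel)
  · exact IsMixingInvolution.isArcTransitive
      (codes := [0, 1, 11, 13, 15, 5, 6, 16, 18, 10, 9, 2, 19, 3, 17, 4, 7, 14, 8, 12])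
      (by decide +kernel)
  · exact IsMixingInvolution.isArcTransitive
      (codes := [0, 1, 2, 12, 15, 5, 6, 7, 17, 10, 9, 11, 3, 19, 18, 4, 16, 8, 14, 13])
      (by decide +kernel)
  · exact IsMixingInvolution.isArcTransitive
      (codes := [0, 1, 13, 20, 8, 9, 21, 16, 4, 5, 17, 12, 11, 2, 18, 15, 7, 10, 14, 23, 3, 6, 22,
        19]) (by decide +kernel)
  · exact IsMixingInvolution.isArcTransitive
      (codes := [0, 24, 43, 19, 20, 44, 39, 15, 16, 40, 35, 11, 12, 36, 31, 7, 8, 32, 27, 3, 4, 28,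
        47, 23, 1, 29, 38, 18, 21, 25, 34, 14, 17, 45, 30, 10, 13, 41, 26, 6, 9, 37, 46, 2, 5, 33,
        42, 22]) (by decide +kernel)

/-- If `2 * s = 0`, the inner vertices have degree less than three, while the outer ones have degree
three, so that the graph is not edge-transitive. -/
theorem not_isEdgeTransitive_of_add_self {n : ℕ} (h1 : (1 : ZMod n) ≠ 0)
    (h2 : (1 : ZMod n) ≠ -1) {s : ZMod n} (hs : s + s = 0) :
    ¬ (genPetersen n s).IsEdgeTransitive := by
  intro h
  obtain ⟨φ, hφ⟩ := h s(.inl 0, .inl 1) (adj_inl_inl (s := s).2 ⟨h1.symm, .inl (sub_zero 1)⟩)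
    s(.inl 0, .inr 0) (adj_inl_inr (s := s).2 (sub_zero 0))
  obtain ⟨j, hj⟩ : ∃ j, φ (.inl j) = .inr 0 := by
    rw [Sym2.map_mk, Sym2.eq_iff] at hφ
    obtain ⟨-, h⟩ | ⟨h, -⟩ := hφ
    exacts [⟨1, h⟩, ⟨0, h⟩]
  -- The three distinct neighbours of an outer vertex would be sent injectively into a set of two
  -- vertices.
  have key : ∀ y, (genPetersen n s).Adj (.inl j) y → φ y = .inl 0 ∨ φ y = .inr s := by
    intro y hy
    have hy' : (genPetersen n s).Adj (φ (.inl j)) (φ y) := φ.map_adj_iff.2 hy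
    rw [hj] at hy'
    generalize φ y = z at hy' ⊢
    rcases z with i | i
    · left; rw [sub_eq_zero.1 (adj_inr_inl.1 hy')]
    · right
      have := (adj_inr_inr.1 hy').2
      rw [neg_eq_of_add_eq_zero_left hs, or_self, sub_zero] at this
      rw [this]
  have a := key (.inl (j + 1)) (adj_inl_inl.2 ⟨by simpa using h1, by simp⟩)
  have b := key (.inl (j - 1)) (adj_inl_inl.2 ⟨by simpa [eq_sub_iff_add_eq] using h1, by simp⟩)
  have c := key (.inr j) (adj_inl_inr.2 (sub_self j))
  have hab : φ (.inl (j + 1)) ≠ φ (.inl (j - 1)) := by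
    simpa [sub_eq_add_neg] using h2
  have hac : φ (.inl (j + 1)) ≠ φ (.inr j) := by simp
  have hbc : φ (.inl (j - 1)) ≠ φ (.inr j) := by simp
  rcases a with a | a <;> rcases b with b | b <;> rcases c with c | c <;>
    simp_all only [ne_eq, not_true_eq_false]

end genPetersen

/-! ### Counting walks -/

theorem SimpleGraph.Iso.adjMatrix_pow_apply {V : Type*} [Fintype V] [DecidableEq V]
    {G : SimpleGraph V} [DecidableRel G.Adj] (φ : G ≃g G) (k : ℕ) (x y : V) :
    (G.adjMatrix ℤ ^ k) (φ x) (φ y) = (G.adjMatrix ℤ ^ k) x y := by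
  induction k generalizing x with
  | zero => simp [Matrix.one_apply]
  | succ k ih =>
    rw [pow_succ', Matrix.mul_apply, Matrix.mul_apply, ← φ.toEquiv.sum_comp]
    refine Finset.sum_congr rfl fun z _ => ?_
    change G.adjMatrix ℤ (φ x) (φ z) * (G.adjMatrix ℤ ^ k) (φ z) (φ y) = _
    rw [ih]
    simp only [SimpleGraph.adjMatrix_apply, φ.map_adj_iff]

/-- Automorphisms preserve walk counts; an edge may be mapped with its ends exchanged, which is
harmless because powers of the adjacency matrix are symmetric. -/
theorem SimpleGraph.IsEdgeTransitive.adjMatrix_pow_eq {V : Type*} [Fintype V] [DecidableEq V]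
    {G : SimpleGraph V} [DecidableRel G.Adj] (hG : G.IsEdgeTransitive) (k : ℕ) {u v x y : V}
    (huv : G.Adj u v) (hxy : G.Adj x y) :
    (G.adjMatrix ℤ ^ k) u v = (G.adjMatrix ℤ ^ k) x y := by
  obtain ⟨φ, h⟩ := hG s(u, v) huv s(x, y) hxy
  rw [← φ.adjMatrix_pow_apply k u v]
  rw [Sym2.map_mk, Sym2.eq_iff] at h
  obtain ⟨h₁, h₂⟩ | ⟨h₁, h₂⟩ := h
  · rw [h₁, h₂]
  · rw [h₁, h₂]
    exact ((G.isSymm_adjMatrix (α := ℤ)).pow k).apply _ _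

/-! ### Computable weight tables on the lattice -/

/-- Finitely supported integer weights on the lattice `ℤ × ℤ`. -/
abbrev WeightTable := List ((ℤ × ℤ) × ℤ)

namespace WeightTable

/-- The weighted sum of the values of `g`. -/
def eval (g : ℤ × ℤ → ℤ) (t : WeightTable) : ℤ := (t.map fun e => e.2 * g e.1).sum

@[simp] theorem eval_nil (g : ℤ × ℤ → ℤ) : eval g [] = 0 := rfl

@[simp] theorem eval_cons (g : ℤ × ℤ → ℤ) (e : (ℤ × ℤ) × ℤ) (t : WeightTable) :
    eval g (e :: t) = e.2 * g e.1 + eval g t := by simp [eval]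

theorem eval_perm (g : ℤ × ℤ → ℤ) {t t' : WeightTable} (h : t.Perm t') : eval g t = eval g t' :=
  (h.map _).sum_eq

theorem eval_congr {g g' : ℤ × ℤ → ℤ} {t : WeightTable} (h : ∀ e ∈ t, g e.1 = g' e.1) :
    eval g t = eval g' t := by
  unfold eval
  rw [List.map_congr_left fun e he => by rw [h e he]]

theorem eval_add (g g' : ℤ × ℤ → ℤ) (t : WeightTable) :
    eval (fun p => g p + g' p) t = eval g t + eval g' t := by
  induction t with
  | nil => rfl
  | cons e t ih => rw [eval_cons, eval_cons, eval_cons, ih]; ring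

@[simp] theorem eval_zero (t : WeightTable) : eval (fun _ => 0) t = 0 := by
  induction t with
  | nil => rfl
  | cons e t ih => simp [ih]

/-- Add the weight `c` at the point `p`. -/
def addTerm (p : ℤ × ℤ) (c : ℤ) : WeightTable → WeightTable
  | [] => [(p, c)]
  | e :: t => if e.1 = p then (p, e.2 + c) :: t else e :: addTerm p c t

theorem eval_addTerm (g : ℤ × ℤ → ℤ) (p : ℤ × ℤ) (c : ℤ) (t : WeightTable) :
    eval g (addTerm p c t) = c * g p + eval g t := by
  induction t with
  | nil => simp [addTerm]
  | cons e t ih =>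
    rw [addTerm]
    split_ifs with h
    · rw [eval_cons, eval_cons, h]; ring
    · rw [eval_cons, eval_cons, ih]; ring

/-- Add to the second table the multiple by `c` of the translate by `d` of the first. -/
def addShift (c : ℤ) (d : ℤ × ℤ) (t t' : WeightTable) : WeightTable :=
  t.foldr (fun e r => addTerm (e.1.1 + d.1, e.1.2 + d.2) (c * e.2) r) t'

theorem eval_addShift (g : ℤ × ℤ → ℤ) (c : ℤ) (d : ℤ × ℤ) (t t' : WeightTable) :
    eval g (addShift c d t t') = c * eval (fun p => g (p.1 + d.1, p.2 + d.2)) t + eval g t' := by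
  induction t with
  | nil => simp [addShift]
  | cons e t ih =>
    change eval g (addTerm _ _ (addShift c d t t')) = _
    rw [eval_addTerm, ih, eval_cons]; ring

/-- The table without its entries of weight zero. -/
def dropZeros (t : WeightTable) : WeightTable := t.filter fun e => e.2 ≠ 0

theorem eval_dropZeros (g : ℤ × ℤ → ℤ) (t : WeightTable) : eval g (dropZeros t) = eval g t := by
  induction t with
  | nil => rfl
  | cons e t ih =>
    rw [dropZeros, List.filter_cons]
    split_ifs with h
    · rw [eval_cons, eval_cons, ← ih]; rfl
    · have h0 : e.2 = 0 := by simpa using h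
      rw [eval_cons, h0, zero_mul, zero_add, ← ih]; rfl

/-- The representative of `{p, -p}` in the closed right half-plane. -/
def halfPlane (p : ℤ × ℤ) : ℤ × ℤ :=
  if p.1 < 0 ∨ p.1 = 0 ∧ p.2 < 0 then (-p.1, -p.2) else p

/-- The table with all weights moved to the right half-plane. -/
def fold (t : WeightTable) : WeightTable := t.foldr (fun e r => addTerm (halfPlane e.1) e.2 r) []

theorem eval_fold {g : ℤ × ℤ → ℤ} (hg : ∀ p, g (-p.1, -p.2) = g p) (t : WeightTable) :
    eval g (fold t) = eval g t := by
  induction t with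
  | nil => rfl
  | cons e t ih =>
    change eval g (addTerm _ _ (fold t)) = _
    rw [eval_addTerm, ih, eval_cons, halfPlane]
    split_ifs
    · rw [hg]
    · rfl

end WeightTable

namespace genPetersen

open WeightTable

/-! ### Walks on the abelian cover -/

/-- One step of all the walks on the universal abelian cover of the generalized Petersen graphs. The
first table holds the numbers of walks ending at the outer vertices, the second table those of walks
ending at the inner vertices. -/
def walkStep (t : WeightTable × WeightTable) : WeightTable × WeightTable :=
  (addShift 1 (1, 0) t.1 (addShift 1 (-1, 0) t.1 t.2),
    addShift 1 (0, 1) t.2 (addShift 1 (0, -1) t.2 t.1))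

/-- The sum of a function on the vertices of a generalized Petersen graph, weighted by two tables on
its cover. -/
def coverSum {n : ℕ} (s : ZMod n) (f : ZMod n ⊕ ZMod n → ℤ) (t : WeightTable × WeightTable) : ℤ :=
  eval (fun p => f (.inl (p.1 + p.2 * s))) t.1 + eval (fun p => f (.inr (p.1 + p.2 * s))) t.2

/-- The indicator function of the relations `a + b * s = 0`. -/
def relationIndicator {n : ℕ} (s : ZMod n) (p : ℤ × ℤ) : ℤ :=
  if (p.1 + p.2 * s : ZMod n) = 0 then 1 else 0

theorem coverSum_single_inl {n : ℕ} {s : ZMod n} (t : WeightTable × WeightTable) :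
    coverSum s (Pi.single (.inl 0) 1) t = eval (relationIndicator s) t.1 := by
  have : (fun p : ℤ × ℤ => (Pi.single (.inl 0) 1 : ZMod n ⊕ ZMod n → ℤ)
      (.inl (p.1 + p.2 * s))) = relationIndicator s := by
    funext p
    simp [Pi.single_apply, relationIndicator]
  rw [coverSum, this]
  simp

theorem coverSum_single_inr {n : ℕ} {s : ZMod n} (t : WeightTable × WeightTable) :
    coverSum s (Pi.single (.inr 0) 1) t = eval (relationIndicator s) t.2 := by
  have : (fun p : ℤ × ℤ => (Pi.single (.inr 0) 1 : ZMod n ⊕ ZMod n → ℤ)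
      (.inr (p.1 + p.2 * s))) = relationIndicator s := by
    funext p
    simp [Pi.single_apply, relationIndicator]
  rw [coverSum, this]
  simp

theorem relationIndicator_neg {n : ℕ} {s : ZMod n} (p : ℤ × ℤ) :
    relationIndicator s (-p.1, -p.2) = relationIndicator s p := by
  have : ((-p.1 : ℤ) + (-p.2 : ℤ) * s : ZMod n) = -(p.1 + p.2 * s) := by push_cast; ring
  simp only [relationIndicator, this, neg_eq_zero]

variable {n : ℕ} [NeZero n] {s : ZMod n}

open Matrix in
theorem adjMatrix_mulVec_inl (h1 : (1 : ZMod n) ≠ 0) (h2 : (1 : ZMod n) ≠ -1)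
    (f : ZMod n ⊕ ZMod n → ℤ) (i : ZMod n) :
    ((genPetersen n s).adjMatrix ℤ *ᵥ f) (.inl i) =
      f (.inl (i + 1)) + f (.inl (i - 1)) + f (.inr i) := by
  have hN : (genPetersen n s).neighborFinset (.inl i) =
      {.inl (i + 1), .inl (i - 1), .inr i} := by
    ext (j | j)
    · have : j = i + 1 ∨ j = i - 1 → i ≠ j := by
        rintro (rfl | rfl) <;> simpa [eq_sub_iff_add_eq] using h1
      simpa [adj_inl_inl, sub_eq_iff_eq_add', ← sub_eq_add_neg] using this
    · simp [adj_inl_inr, sub_eq_zero]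
  rw [SimpleGraph.adjMatrix_mulVec_apply, hN, Finset.sum_insert, Finset.sum_insert,
    Finset.sum_singleton, add_assoc]
  · simp
  · simpa [sub_eq_add_neg] using h2

open Matrix in
theorem adjMatrix_mulVec_inr (hs : s ≠ 0) (hs' : s ≠ -s)
    (f : ZMod n ⊕ ZMod n → ℤ) (i : ZMod n) :
    ((genPetersen n s).adjMatrix ℤ *ᵥ f) (.inr i) =
      f (.inr (i + s)) + f (.inr (i - s)) + f (.inl i) := by
  have hN : (genPetersen n s).neighborFinset (.inr i) =
      {.inr (i + s), .inr (i - s), .inl i} := by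
    ext (j | j)
    · simp [adj_inr_inl, sub_eq_zero]
    · have : j = i + s ∨ j = i - s → i ≠ j := by
        rintro (rfl | rfl) <;> simpa [eq_sub_iff_add_eq] using hs
      simpa [adj_inr_inr, sub_eq_iff_eq_add', ← sub_eq_add_neg] using this
  rw [SimpleGraph.adjMatrix_mulVec_apply, hN, Finset.sum_insert, Finset.sum_insert,
    Finset.sum_singleton, add_assoc]
  · simp
  · simpa [sub_eq_add_neg] using hs'

-- Pushing walks one step forward on the cover is adjoint to applying the adjacency matrix to
-- functions on the quotient. The four conditions on `1` and `s` keep the three neighbours of every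
-- vertex distinct.
open Matrix in
theorem coverSum_walkStep (h1 : (1 : ZMod n) ≠ 0) (h2 : (1 : ZMod n) ≠ -1) (hs : s ≠ 0)
    (hs' : s ≠ -s) (f : ZMod n ⊕ ZMod n → ℤ) (t : WeightTable × WeightTable) :
    coverSum s f (walkStep t) = coverSum s ((genPetersen n s).adjMatrix ℤ *ᵥ f) t := by
  simp only [coverSum, walkStep, eval_addShift, adjMatrix_mulVec_inl h1 h2,
    adjMatrix_mulVec_inr hs hs', eval_add, one_mul]
  have e1 (p : ℤ × ℤ) : ((p.1 + 1 : ℤ) : ZMod n) + ((p.2 + 0 : ℤ) : ZMod n) * s =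
      p.1 + p.2 * s + 1 := by push_cast; ring
  have e2 (p : ℤ × ℤ) : ((p.1 + -1 : ℤ) : ZMod n) + ((p.2 + 0 : ℤ) : ZMod n) * s =
      p.1 + p.2 * s - 1 := by push_cast; ring
  have e3 (p : ℤ × ℤ) : ((p.1 + 0 : ℤ) : ZMod n) + ((p.2 + 1 : ℤ) : ZMod n) * s =
      p.1 + p.2 * s + s := by push_cast; ring
  have e4 (p : ℤ × ℤ) : ((p.1 + 0 : ℤ) : ZMod n) + ((p.2 + -1 : ℤ) : ZMod n) * s =
      p.1 + p.2 * s - s := by push_cast; ring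
  simp only [e1, e2, e3, e4]
  ring

open Matrix in
theorem coverSum_walkStep_iterate (h1 : (1 : ZMod n) ≠ 0) (h2 : (1 : ZMod n) ≠ -1) (hs : s ≠ 0)
    (hs' : s ≠ -s) (f : ZMod n ⊕ ZMod n → ℤ) (t : WeightTable × WeightTable) (k : ℕ) :
    coverSum s f (walkStep^[k] t) = coverSum s ((genPetersen n s).adjMatrix ℤ ^ k *ᵥ f) t := by
  induction k generalizing t with
  | zero => simp
  | succ k ih =>
    rw [Function.iterate_succ_apply, ih, coverSum_walkStep h1 h2 hs hs', Matrix.mulVec_mulVec,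
      ← pow_succ']

/-- The walks of length `k` on the cover from the outer vertex at `(-1, 0)` to outer vertices. -/
def outerTable (k : ℕ) : WeightTable := (walkStep^[k] ([((-1, 0), 1)], [])).1

/-- The walks of length `k` on the cover from the outer vertex at `(0, 0)` to inner vertices. -/
def spokeTable (k : ℕ) : WeightTable := (walkStep^[k] ([((0, 0), 1)], [])).2

/-- The walks of length `k` on the cover from the inner vertex at `(0, -1)` to inner vertices. -/
def innerTable (k : ℕ) : WeightTable := (walkStep^[k] ([], [((0, -1), 1)])).2

/-- Starting at the lift `(-1, 0)` puts the other end of the edge over `0`, so its lifts are exactly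
the relations. The same choice for the other edge types lets one indicator serve all three tables.
-/
theorem eval_outerTable (h1 : (1 : ZMod n) ≠ 0) (h2 : (1 : ZMod n) ≠ -1) (hs : s ≠ 0)
    (hs' : s ≠ -s) (k : ℕ) : eval (relationIndicator s) (outerTable k) =
    ((genPetersen n s).adjMatrix ℤ ^ k) (.inl (-1)) (.inl 0) := by
  rw [outerTable, ← coverSum_single_inl, coverSum_walkStep_iterate h1 h2 hs hs']
  simp [coverSum]

theorem eval_spokeTable (h1 : (1 : ZMod n) ≠ 0) (h2 : (1 : ZMod n) ≠ -1) (hs : s ≠ 0)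
    (hs' : s ≠ -s) (k : ℕ) : eval (relationIndicator s) (spokeTable k) =
    ((genPetersen n s).adjMatrix ℤ ^ k) (.inl 0) (.inr 0) := by
  rw [spokeTable, ← coverSum_single_inr, coverSum_walkStep_iterate h1 h2 hs hs']
  simp [coverSum]

theorem eval_innerTable (h1 : (1 : ZMod n) ≠ 0) (h2 : (1 : ZMod n) ≠ -1) (hs : s ≠ 0)
    (hs' : s ≠ -s) (k : ℕ) : eval (relationIndicator s) (innerTable k) =
    ((genPetersen n s).adjMatrix ℤ ^ k) (.inr (-s)) (.inr 0) := by
  rw [innerTable, ← coverSum_single_inr, coverSum_walkStep_iterate h1 h2 hs hs']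
  simp [coverSum]

/-! ### Defect tables -/

/-- `D` represents the difference between the numbers of walks of length `k` that join the ends of
an outer edge and of a spoke. -/
def IsOuterDefect (k : ℕ) (D : WeightTable) : Prop :=
  (dropZeros (fold (addShift (-1) (0, 0) (spokeTable k) (outerTable k)))).Perm D

/-- `D` represents the difference between the numbers of walks of length `k` that join the ends of
an inner edge and of a spoke. -/
def IsInnerDefect (k : ℕ) (D : WeightTable) : Prop :=
  (dropZeros (fold (addShift (-1) (0, 0) (spokeTable k) (innerTable k)))).Perm D

instance (k : ℕ) (D : WeightTable) : Decidable (IsOuterDefect k D) := by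
  unfold IsOuterDefect; infer_instance

instance (k : ℕ) (D : WeightTable) : Decidable (IsInnerDefect k D) := by
  unfold IsInnerDefect; infer_instance

theorem IsOuterDefect.eval_eq_zero {k : ℕ} {D : WeightTable} (hD : IsOuterDefect k D)
    (h1 : (1 : ZMod n) ≠ 0) (h2 : (1 : ZMod n) ≠ -1) (hs : s ≠ 0) (hs' : s ≠ -s)
    (hG : (genPetersen n s).IsEdgeTransitive) : eval (relationIndicator s) D = 0 := by
  have spoke : (genPetersen n s).Adj (.inl 0) (.inr 0) := adj_inl_inr.2 (sub_zero 0)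
  have outer : (genPetersen n s).Adj (.inl (-1)) (.inl 0) :=
    adj_inl_inl.2 ⟨by simpa using h1, by simp⟩
  rw [← eval_perm _ hD, eval_dropZeros, eval_fold relationIndicator_neg, eval_addShift]
  simp only [add_zero, Prod.mk.eta]
  rw [eval_outerTable h1 h2 hs hs', eval_spokeTable h1 h2 hs hs',
    hG.adjMatrix_pow_eq k outer spoke]
  simp

theorem IsInnerDefect.eval_eq_zero {k : ℕ} {D : WeightTable} (hD : IsInnerDefect k D)
    (h1 : (1 : ZMod n) ≠ 0) (h2 : (1 : ZMod n) ≠ -1) (hs : s ≠ 0) (hs' : s ≠ -s)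
    (hG : (genPetersen n s).IsEdgeTransitive) : eval (relationIndicator s) D = 0 := by
  have spoke : (genPetersen n s).Adj (.inl 0) (.inr 0) := adj_inl_inr.2 (sub_zero 0)
  have inner : (genPetersen n s).Adj (.inr (-s)) (.inr 0) :=
    adj_inr_inr.2 ⟨by simpa using hs, by simp⟩
  rw [← eval_perm _ hD, eval_dropZeros, eval_fold relationIndicator_neg, eval_addShift]
  simp only [add_zero, Prod.mk.eta]
  rw [eval_innerTable h1 h2 hs hs', eval_spokeTable h1 h2 hs hs',
    hG.adjMatrix_pow_eq k inner spoke]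
  simp

/-- The defect table of outer edges for walks of length seven. -/
def outerDefectSeven : WeightTable :=
  [((0, 0), -2), ((0, 2), -88), ((0, 4), -22), ((0, 6), -2), ((1, -5), -1), ((1, -3), -14),
   ((1, -1), -34), ((1, 1), -34), ((1, 3), -14), ((1, 5), -1), ((2, -2), -1), ((2, 0), 106),
   ((2, 2), -1), ((3, -3), 1), ((3, -1), 14), ((3, 1), 14), ((3, 3), 1), ((4, -2), 2),
   ((4, 0), 56), ((4, 2), 2), ((5, -1), 3), ((5, 1), 3), ((6, 0), 12), ((8, 0), 1)]

/-- The defect table of inner edges for walks of length seven. -/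
def innerDefectSeven : WeightTable := outerDefectSeven.map fun e => (halfPlane e.1.swap, e.2)

/-- The defect table of outer edges for walks of length nine. -/
def outerDefectNine : WeightTable :=
  [((0, 0), -30), ((0, 2), -550), ((0, 4), -188), ((0, 6), -30), ((0, 8), -2), ((1, -7), -1),
   ((1, -5), -22), ((1, -3), -140), ((1, -1), -200), ((1, 1), -200), ((1, 3), -140),
   ((1, 5), -22), ((1, 7), -1), ((2, -4), -7), ((2, -2), -16), ((2, 0), 578), ((2, 2), -16),
   ((2, 4), -7), ((3, -5), 1), ((3, -3), 12), ((3, -1), 136), ((3, 1), 136), ((3, 3), 12),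
   ((3, 5), 1), ((4, -4), 2), ((4, -2), 32), ((4, 0), 380), ((4, 2), 32), ((4, 4), 2),
   ((5, -3), 3), ((5, -1), 50), ((5, 1), 50), ((5, 3), 3), ((6, -2), 4), ((6, 0), 108),
   ((6, 2), 4), ((7, -1), 5), ((7, 1), 5), ((8, 0), 16), ((10, 0), 1)]

theorem isOuterDefect_seven : IsOuterDefect 7 outerDefectSeven := by decide +kernel

/-- Exchanging the rims together with the coordinates is a symmetry of the cover, so the inner table
is the outer one with coordinates swapped, up to the choice of sign made by `halfPlane`. -/
theorem isInnerDefect_seven : IsInnerDefect 7 innerDefectSeven := by decide +kernel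

theorem isOuterDefect_nine : IsOuterDefect 9 outerDefectNine := by decide +kernel

/-! ### The lattice of relations -/

/-- The indicator function of the integer multiples of `w`. -/
def multipleIndicator (w p : ℤ × ℤ) : ℤ :=
  if p.1 * w.2 = p.2 * w.1 ∧ w.1 ∣ p.1 ∧ w.2 ∣ p.2 then 1 else 0

/-- The indicator function of the pairs `(a, b)` with `a + b * m` divisible by `n`. -/
def dvdIndicator (n m : ℤ) (p : ℤ × ℤ) : ℤ :=
  if (p.1 + p.2 * m) % n = 0 then 1 else 0

theorem relationIndicator_eq (p : ℤ × ℤ) :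
    relationIndicator s p = dvdIndicator n s.val p := by
  have : (p.1 + p.2 * s : ZMod n) = 0 ↔ (p.1 + p.2 * (s.val : ℤ)) % (n : ℤ) = 0 := by
    rw [← Int.dvd_iff_emod_eq_zero, ← ZMod.intCast_zmod_eq_zero_iff_dvd]
    simp
  simp only [relationIndicator, dvdIndicator, this]

/-- The left side is the decidable form used for kernel evaluation. Both divisibilities are required
because either coordinate of `w` may vanish. -/
theorem exists_smul_iff (w p : ℤ × ℤ) :
    (p.1 * w.2 = p.2 * w.1 ∧ w.1 ∣ p.1 ∧ w.2 ∣ p.2) ↔ ∃ q : ℤ, p.1 = q * w.1 ∧ p.2 = q * w.2 := by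
  constructor
  · rintro ⟨h, ⟨a, ha⟩, b, hb⟩
    by_cases hw : w.1 = 0
    · exact ⟨b, by rw [ha, hw]; ring, by rw [hb]; ring⟩
    · refine ⟨a, by rw [ha]; ring, mul_right_cancel₀ hw ?_⟩
      rw [← h, ha]; ring
  · rintro ⟨q, h₁, h₂⟩
    exact ⟨by rw [h₁, h₂]; ring, ⟨q, by rw [h₁]; ring⟩, q, by rw [h₂]; ring⟩

/-- For `n > R`, the relations `a + b * m ≡ 0` modulo `n` within the disc of squared radius `R` are
the multiples of a single vector of that disc. -/
theorem exists_generator (n m : ℤ) {R : ℤ} (hR : 0 ≤ R) (hn : R < n) :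
    ∃ w : ℤ × ℤ, w.1 * w.1 + w.2 * w.2 ≤ R ∧ ∀ p : ℤ × ℤ, p.1 * p.1 + p.2 * p.2 ≤ R →
      dvdIndicator n m p = multipleIndicator w p := by
  suffices H : ∃ w : ℤ × ℤ, w.1 * w.1 + w.2 * w.2 ≤ R ∧ n ∣ w.1 + w.2 * m ∧
      ∀ p : ℤ × ℤ, p.1 * p.1 + p.2 * p.2 ≤ R → n ∣ p.1 + p.2 * m →
        ∃ q : ℤ, p.1 = q * w.1 ∧ p.2 = q * w.2 by
    obtain ⟨w, hw, hwL, H⟩ := H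
    refine ⟨w, hw, fun p hp => ?_⟩
    unfold dvdIndicator multipleIndicator
    refine if_congr ?_ rfl rfl
    rw [← Int.dvd_iff_emod_eq_zero, exists_smul_iff]
    refine ⟨H p hp, ?_⟩
    rintro ⟨q, h₁, h₂⟩
    obtain ⟨c, hc⟩ := hwL
    exact ⟨q * c, by rw [h₁, h₂]; linear_combination q * hc⟩
  -- The generator is a shortest nonzero relation in the disc, or `0` if there is none.
  by_cases hex : ∃ N : ℕ, ∃ w : ℤ × ℤ, w ≠ 0 ∧ w.1 * w.1 + w.2 * w.2 = N ∧ (N : ℤ) ≤ R ∧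
      n ∣ w.1 + w.2 * m
  · classical
    obtain ⟨w, hw0, hwN, hNR, hwL⟩ := Nat.find_spec hex
    set N := Nat.find hex
    have hwpos : 0 < w.1 * w.1 + w.2 * w.2 := by
      by_contra hcon
      have h₁ : w.1 = 0 := by nlinarith [mul_self_nonneg w.1, mul_self_nonneg w.2]
      have h₂ : w.2 = 0 := by nlinarith [mul_self_nonneg w.1, mul_self_nonneg w.2]
      exact hw0 (Prod.ext h₁ h₂)
    refine ⟨w, hwN.trans_le hNR, hwL, fun p hp hpL => ?_⟩
    -- The determinant of two relations is a multiple of `n`; by Lagrange's identity its absolute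
    -- value is at most `R < n`.
    have hdet : p.1 * w.2 - p.2 * w.1 = 0 := by
      refine Int.eq_zero_of_abs_lt_dvd (m := n) ?_ (lt_of_le_of_lt ?_ hn)
      · obtain ⟨c, hc⟩ := hpL
        obtain ⟨d, hd⟩ := hwL
        exact ⟨c * w.2 - d * p.2, by linear_combination w.2 * hc - p.2 * hd⟩
      · refine abs_le_of_sq_le_sq ?_ hR
        nlinarith [mul_self_nonneg (p.1 * w.1 + p.2 * w.2), mul_le_mul hp (hwN.trans_le hNR)
          hwpos.le hR]
    set W := w.1 * w.1 + w.2 * w.2 with hW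
    set q := (p.1 * w.1 + p.2 * w.2) / W with hq
    set c := (p.1 * w.1 + p.2 * w.2) % W with hc
    have hdiv : W * q + c = p.1 * w.1 + p.2 * w.2 := Int.mul_ediv_add_emod _ _
    have hc0 : 0 ≤ c := Int.emod_nonneg _ hwpos.ne'
    have hcW : c < W := Int.emod_lt_of_pos _ hwpos
    -- The remainder `p - q * w` is parallel to `w` and has inner product `c < W` with it, so it is
    -- shorter than `w`; by minimality it is zero.
    have hr : (p.1 - q * w.1) * (p.1 - q * w.1) + (p.2 - q * w.2) * (p.2 - q * w.2) < W := by
      refine lt_of_mul_lt_mul_right (a := W) ?_ hwpos.le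
      have : ((p.1 - q * w.1) * (p.1 - q * w.1) + (p.2 - q * w.2) * (p.2 - q * w.2)) * W
          = c * c := by
        have hc' : c = p.1 * w.1 + p.2 * w.2 - W * q := by linarith
        rw [hc', hW]
        linear_combination (p.1 * w.2 - p.2 * w.1) * hdet
      rw [this]
      exact mul_self_lt_mul_self hc0 hcW
    have hr0 : 0 ≤ (p.1 - q * w.1) * (p.1 - q * w.1) + (p.2 - q * w.2) * (p.2 - q * w.2) :=
      add_nonneg (mul_self_nonneg _) (mul_self_nonneg _)
    obtain ⟨M, hM⟩ := Int.eq_ofNat_of_zero_le hr0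
    by_cases hz : ((p.1 - q * w.1, p.2 - q * w.2) : ℤ × ℤ) = 0
    · rw [Prod.mk_eq_zero, sub_eq_zero, sub_eq_zero] at hz
      exact ⟨q, hz⟩
    · refine absurd ⟨(p.1 - q * w.1, p.2 - q * w.2), hz, hM, by omega, ?_⟩
        (Nat.find_min hex (m := M) (by omega))
      obtain ⟨c, hc⟩ := hpL
      obtain ⟨d, hd⟩ := hwL
      exact ⟨c - q * d, by linear_combination hc - q * hd⟩
  · refine ⟨0, by simpa using hR, by simp, fun p hp hpL => ⟨0, ?_⟩⟩
    by_contra hcon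
    have hp0 : 0 ≤ p.1 * p.1 + p.2 * p.2 := add_nonneg (mul_self_nonneg _) (mul_self_nonneg _)
    obtain ⟨M, hM⟩ := Int.eq_ofNat_of_zero_le hp0
    refine hex ⟨M, p, ?_, hM, by omega, hpL⟩
    rintro rfl
    simp at hcon

/-! ### Finite checks and the classification -/

/-- The bound `64` is attained at `(8, 0)`: seven backward steps from `(-1, 0)`, then folded. It
fixes the radius, and hence the threshold `n < 65`. -/
theorem defectSeven_norm_le :
    ∀ e ∈ outerDefectSeven ++ innerDefectSeven, e.1.1 * e.1.1 + e.1.2 * e.1.2 ≤ 64 := by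
  decide +kernel

/-- No lattice of relations of rank at most one balances the numbers of walks of length seven. -/
theorem defectSeven_multiple_ne_zero : ∀ i < 17, ∀ j < 17,
    eval (multipleIndicator ((i : ℕ) - 8, (j : ℕ) - 8)) outerDefectSeven ≠ 0 ∨
      eval (multipleIndicator ((i : ℕ) - 8, (j : ℕ) - 8)) innerDefectSeven ≠ 0 := by
  decide +kernel

set_option synthInstance.maxSize 1000 in
/-- For small `n`, the walks of length seven and nine leave only the exceptional parameters. -/
theorem mem_gpPairs_of_eval_defect_eq_zero : ∀ n < 65, ∀ m < n,
    (2 < n ∧ 0 < m ∧ m + m < n ∧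
      eval (dvdIndicator (n : ℕ) (m : ℕ)) outerDefectSeven = 0 ∧
      eval (dvdIndicator (n : ℕ) (m : ℕ)) innerDefectSeven = 0 ∧
      eval (dvdIndicator (n : ℕ) (m : ℕ)) outerDefectNine = 0) → (n, m) ∈ gpPairs := by
  decide +kernel

theorem mem_gpPairs_of_isEdgeTransitive (hn : 3 ≤ n) (hs : s ≠ 0) (hval : s.val + s.val ≤ n)
    (hG : (genPetersen n s).IsEdgeTransitive) : (n, s.val) ∈ gpPairs := by
  have h1 : (1 : ZMod n) ≠ 0 := by
    have := (ZMod.natCast_eq_zero_iff 1 n).not.2 fun h => by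
      have := Nat.le_of_dvd one_pos h; omega
    exact_mod_cast this
  have h2 : (1 : ZMod n) ≠ -1 := by
    have := (ZMod.natCast_eq_zero_iff 2 n).not.2 fun h => by
      have := Nat.le_of_dvd two_pos h; omega
    rw [Ne, eq_neg_iff_add_eq_zero, one_add_one_eq_two]
    exact_mod_cast this
  -- Here the inner vertices are not of degree three, and the walk tables do not apply.
  by_cases hs' : s = -s
  · exact absurd hG (not_isEdgeTransitive_of_add_self h1 h2 (eq_neg_iff_add_eq_zero.1 hs'))
  have hind : relationIndicator s = dvdIndicator n s.val := funext relationIndicator_eq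
  have ho := isOuterDefect_seven.eval_eq_zero h1 h2 hs hs' hG
  have hi := isInnerDefect_seven.eval_eq_zero h1 h2 hs hs' hG
  have hnine := isOuterDefect_nine.eval_eq_zero h1 h2 hs hs' hG
  rw [hind] at ho hi hnine
  by_cases hlt : n < 65
  · refine mem_gpPairs_of_eval_defect_eq_zero n hlt s.val s.val_lt
      ⟨hn, ZMod.val_pos.2 hs, lt_of_le_of_ne hval fun h => hs' ?_, ho, hi, hnine⟩
    have : ((s.val + s.val : ℕ) : ZMod n) = 0 := by rw [h, ZMod.natCast_self]
    rw [eq_neg_iff_add_eq_zero]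
    simpa using this
  · obtain ⟨w, hw, H⟩ := exists_generator n s.val (R := 64) (by norm_num) (by omega)
    have e1 : eval (multipleIndicator w) outerDefectSeven = 0 := by
      rw [← ho]
      exact eval_congr fun e he =>
        (H _ (defectSeven_norm_le e (List.mem_append_left _ he))).symm
    have e2 : eval (multipleIndicator w) innerDefectSeven = 0 := by
      rw [← hi]
      exact eval_congr fun e he =>
        (H _ (defectSeven_norm_le e (List.mem_append_right _ he))).symm
    have b1 : |w.1| ≤ 8 := abs_le_of_sq_le_sq (by nlinarith [mul_self_nonneg w.2]) (by norm_num)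
    have b2 : |w.2| ≤ 8 := abs_le_of_sq_le_sq (by nlinarith [mul_self_nonneg w.1]) (by norm_num)
    rw [abs_le] at b1 b2
    -- The shift by 8 matches the enumeration of `[-8, 8]` by `i < 17` in the finite check.
    have hw' : w = (((w.1 + 8).toNat : ℤ) - 8, ((w.2 + 8).toNat : ℤ) - 8) := by
      ext <;> simp only <;> omega
    rw [hw'] at e1 e2
    obtain h | h := defectSeven_multiple_ne_zero (w.1 + 8).toNat (by omega) (w.2 + 8).toNat
      (by omega)
    · exact absurd e1 h
    · exact absurd e2 h

end genPetersen

/-- Since `GP(n,s)` and `GP(n,-s)` are the same graph, the parameter `s : ZMod n` is compared with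
the list up to sign, through the representatives of `s` and `-s` in `{0, …, n-1}`. -/
theorem theoremt (n : ℕ) (hn : 3 ≤ n) (s : ZMod n) (hs : s ≠ 0) :
    ((genPetersen n s).IsEdgeTransitive ↔ (n, s.val) ∈ gpPairs ∨ (n, (-s).val) ∈ gpPairs) ∧
      ((genPetersen n s).IsEdgeTransitive → (genPetersen n s).IsArcTransitive) := by
  have : NeZero n := ⟨by omega⟩
  have arc (h : (n, s.val) ∈ gpPairs ∨ (n, (-s).val) ∈ gpPairs) :
      (genPetersen n s).IsArcTransitive := by
    obtain h | h := h
    · simpa using genPetersen.isArcTransitive_of_mem_gpPairs h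
    · simpa [genPetersen.eq_neg] using genPetersen.isArcTransitive_of_mem_gpPairs h
  have forward (h : (genPetersen n s).IsEdgeTransitive) :
      (n, s.val) ∈ gpPairs ∨ (n, (-s).val) ∈ gpPairs := by
    by_cases hval : s.val + s.val ≤ n
    · exact .inl (genPetersen.mem_gpPairs_of_isEdgeTransitive hn hs hval h)
    · have hneg : (-s).val + (-s).val ≤ n := by
        rw [ZMod.neg_val, if_neg hs]; omega
      rw [← genPetersen.eq_neg] at h
      exact .inr (genPetersen.mem_gpPairs_of_isEdgeTransitive hn (neg_ne_zero.2 hs) hneg h)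
  exact ⟨⟨forward, fun h => (arc h).isEdgeTransitive⟩, fun h => arc (forward h)⟩
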